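/- Let $n\ge 0$ and let $P$ be a homogeneous real polynomial in the entries $X_{ij}=X_{ji}$ of a symmetric $n\times n$ matrix $X$ of indeterminates. Suppose that $P$ is a linear principal minor (lpm) polynomial, i.e. $P(X)=\sum_{J\subseteq[n]}c_J\det(X_J)$ with $c_J\in\mathbb{R}$, where $X_J$ is the principal submatrix of $X$ indexed by $J$; that $P$ is PSD-stable, i.e. $P(Z)\neq 0$ for every complex symmetric $n\times n$ matrix $Z$ with positive definite imaginary part; and that $P$ is normalized by $P(I)>0$. Let $H(P)$ be its hyperbolicity cone with respect to the identity matrix $I$, i.e. the set of all real symmetric $A$ such that $t\mapsto P(A-tI)$ has only nonnegative roots. Let $\Pi$ be a partition of $[n]=\{1,\dots,n\}$, and let $\pi_\Pi$ be the orthogonal projection from the real symmetric $n\times n$ matrices onto those that are block diagonal with respect to $\Pi$ (the matrices $A$ with $A_{ij}=0$ whenever $i,j$ lie in different blocks of $\Pi$). Then $$P(\pi_\Pi(A))\ \ge\ P(A)\qquad\text{for all } A\in H(P).$$ -/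

import Mathlib

namespace LPM

open MvPolynomial

/-- Polynomials on the space of symmetric `n × n` matrices: one indeterminate `X_{ij} = X_{ji}`
for each unordered pair `{i, j}` (with `i = j` allowed). -/
abbrev SymPoly (n : ℕ) : Type := MvPolynomial (Sym2 (Fin n)) ℝ

/-- The symmetric `n × n` matrix of indeterminates. -/
noncomputable def genericMatrix (n : ℕ) : Matrix (Fin n) (Fin n) (SymPoly n) :=
  Matrix.of fun i j => X s(i, j)

/-- The value of `P` at a symmetric matrix `A` with entries in a commutative real algebra. The
unordered pair `{i, j}` is read at its ordered representative, so that the value is defined without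
a proof of symmetry; it is only ever used at symmetric `A`. -/
noncomputable def evalAt {n : ℕ} {R : Type*} [CommRing R] [Algebra ℝ R]
    (A : Matrix (Fin n) (Fin n) R) (P : SymPoly n) : R :=
  aeval (fun e : Sym2 (Fin n) => A e.inf e.sup) P

/-- Evaluation at a symmetric matrix `A` substitutes `A i j` for the indeterminate `X_{ij}`. -/
theorem evalAt_X {n : ℕ} {R : Type*} [CommRing R] [Algebra ℝ R]
    {A : Matrix (Fin n) (Fin n) R} (hA : A.IsSymm) (i j : Fin n) :
    evalAt A (X s(i, j)) = A i j := by
  rcases le_total i j with h | h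
  · simp [evalAt, h]
  · simp [evalAt, h, hA.apply i j]

/-- Linear principal minor polynomials: `P = ∑_J c_J det(X_J)`, over all subsets `J` of `[n]`. -/
def IsLPM {n : ℕ} (P : SymPoly n) : Prop :=
  ∃ c : Finset (Fin n) → ℝ,
    P = ∑ J : Finset (Fin n),
      C (c J) * ((genericMatrix n).submatrix (fun i : J => (i : Fin n)) (fun i : J => (i : Fin n))).det

/-- `P` has no zero in the Siegel upper half-plane, i.e. among the complex symmetric matrices with
positive definite imaginary part. -/
def IsPSDStable {n : ℕ} (P : SymPoly n) : Prop :=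
  ∀ Z : Matrix (Fin n) (Fin n) ℂ, Z.IsSymm → (Z.map Complex.im).PosDef → evalAt Z P ≠ 0

/-- The hyperbolicity cone `H(P)` with respect to the identity matrix: the real symmetric `A` such
that `t ↦ P(A - t I)` has only nonnegative roots. -/
def hyperbolicityCone {n : ℕ} (P : SymPoly n) : Set (Matrix (Fin n) (Fin n) ℝ) :=
  {A | A.IsSymm ∧ ∀ t : ℝ, evalAt (A - t • (1 : Matrix (Fin n) (Fin n) ℝ)) P = 0 → 0 ≤ t}

/-- `i ∼ j`: the indices `i` and `j` lie in the same block of the partition `Q`. -/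
def SameBlock {n : ℕ} (Q : Finpartition (Finset.univ : Finset (Fin n))) (i j : Fin n) : Prop :=
  ∃ S ∈ Q.parts, i ∈ S ∧ j ∈ S

/-- The symmetric matrices that are block diagonal with respect to `Q`. -/
def blockDiagonal {n : ℕ} (Q : Finpartition (Finset.univ : Finset (Fin n))) :
    Submodule ℝ (Matrix (Fin n) (Fin n) ℝ) where
  carrier := {A | A.IsSymm ∧ ∀ i j, ¬ SameBlock Q i j → A i j = 0}
  add_mem' := fun ⟨ha, ha'⟩ ⟨hb, hb'⟩ =>
    ⟨ha.add hb, fun i j h => by simp [ha' i j h, hb' i j h]⟩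
  zero_mem' := ⟨Matrix.isSymm_zero, fun _ _ _ => rfl⟩
  smul_mem' := fun c _ ⟨ha, ha'⟩ => ⟨ha.smul c, fun i j h => by simp [ha' i j h]⟩

open Classical in
/-- The orthogonal projection `π_Q` of symmetric matrices onto the block diagonal ones: all entries
outside the blocks are replaced by zero. -/
noncomputable def blockProj {n : ℕ} (Q : Finpartition (Finset.univ : Finset (Fin n)))
    (A : Matrix (Fin n) (Fin n) ℝ) : Matrix (Fin n) (Fin n) ℝ :=
  Matrix.of fun i j => if SameBlock Q i j then A i j else 0

theorem SameBlock.symm {n : ℕ} {Q : Finpartition (Finset.univ : Finset (Fin n))} {i j : Fin n}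
    (h : SameBlock Q i j) : SameBlock Q j i := by
  obtain ⟨S, hS, hi, hj⟩ := h
  exact ⟨S, hS, hj, hi⟩

theorem blockProj_mem {n : ℕ} (Q : Finpartition (Finset.univ : Finset (Fin n)))
    {A : Matrix (Fin n) (Fin n) ℝ} (hA : A.IsSymm) : blockProj Q A ∈ blockDiagonal Q := by
  refine ⟨?_, fun i j h => by simp [blockProj, h]⟩
  ext i j
  by_cases h : SameBlock Q i j
  · simp [blockProj, h, h.symm, hA.apply i j]
  · have h' : ¬ SameBlock Q j i := fun h' => h h'.symm
    simp [blockProj, h, h']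

/-- `blockProj Q A` is the orthogonal projection of `A` for the trace inner product
`⟨D, A⟩ = tr(Dᵀ A)`. -/
theorem blockProj_orthogonal {n : ℕ} (Q : Finpartition (Finset.univ : Finset (Fin n)))
    (A : Matrix (Fin n) (Fin n) ℝ) :
    ∀ D ∈ blockDiagonal Q, (D.transpose * (A - blockProj Q A)).trace = 0 := by
  intro D hD
  simp only [Matrix.trace, Matrix.diag, Matrix.mul_apply, Matrix.transpose_apply, Matrix.sub_apply]
  refine Finset.sum_eq_zero fun i _ => Finset.sum_eq_zero fun j _ => ?_
  by_cases h : SameBlock Q j i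
  · simp [blockProj, h]
  · simp [hD.2 j i h]

end LPM

/-!
A partition with blocks `S₁, …, S_k` is treated one block at a time. Erasing the entries of `A` that
join `S` to its complement is the midpoint of `A` and `D A D`, where `D` is the diagonal sign matrix
with `-1` on `S`. Principal minors, hence lpm polynomials, take the same value at `A` and `D A D`
(`LPM.evalAt_signConj`). So it suffices that `P((A + B) / 2) ≥ P(A)` whenever `A` and `B` lie in the
hyperbolicity cone and `P(A) = P(B)`, and that the cone is convex. Both are parts of Gårding's theory
of hyperbolic polynomials, proved below for a homogeneous `p` on `σ → ℝ`:

* PSD-stability makes `P` hyperbolic with respect to `I`. For `a`, `b` in the open cone, the zeros of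
  `z ↦ p(z a + w b + v e)` depend continuously on `w` and `v` and cannot cross the real axis, so
  `p(z a + w b + v e) ≠ 0` for `z`, `w`, `v` in the upper half-plane
  (`aeval_ne_zero_of_homotopy`, `aeval_three_ne_zero`). Convexity of the cone follows.
* Consequently `z ↦ p(z a + b)` has only negative roots `-ρᵢ`. If `p(a) = p(b)`, then `∏ ρᵢ = 1`,
  so `p(a + b) = p(a) ∏ (1 + ρᵢ) ≥ p(a) ∏ 2 √ρᵢ = 2 ^ d p(a)` (`aeval_le_aeval_midpoint`).

Matrices on the boundary of the cone are limits of `A + t I` as `t → 0⁺`.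
-/

open MvPolynomial Filter Topology

/-! ### Homogeneous polynomials on complex lines -/

section Hyperbolic

variable {σ : Type*}

theorem degree_eq_of_mem_support {p : MvPolynomial σ ℝ} {d : ℕ} (hp : p.IsHomogeneous d)
    {k : σ →₀ ℕ} (hk : k ∈ p.support) : k.degree = d := by
  by_contra h
  exact mem_support_iff.1 hk (hp.coeff_eq_zero h)

/-- A homogeneous polynomial can be restricted to the complex line `z ↦ z a + m`; if it does not
vanish at `a`, the restriction has degree `d` and leading coefficient `p(a)`, hence splits. -/
theorem exists_multiset_aeval_line [Fintype σ] {p : MvPolynomial σ ℝ} {d : ℕ}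
    (hp : p.IsHomogeneous d) (a m : σ → ℂ) (ha : aeval a p ≠ 0) :
    ∃ s : Multiset ℂ, Multiset.card s = d ∧
      ∀ z : ℂ, aeval (fun i => z * a i + m i) p = aeval a p * (s.map fun r => z - r).prod := by
  classical
  set l : σ → Polynomial ℂ := fun i => Polynomial.X * Polynomial.C (a i) + Polynomial.C (m i)
    with hl
  set q : Polynomial ℂ := aeval l p with hq
  have heval : ∀ z, q.eval z = aeval (fun i => z * a i + m i) p := by
    intro z
    have := MvPolynomial.map_aeval l (Polynomial.evalRingHom z) p
    rw [← Polynomial.coe_evalRingHom, hq, this, aeval_def, coe_eval₂Hom]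
    congr 1
    · ext x; simp [Polynomial.algebraMap_apply]
    · ext i
      change (Polynomial.X * Polynomial.C (a i) + Polynomial.C (m i)).eval z = _
      simp only [Polynomial.eval_add, Polynomial.eval_mul, Polynomial.eval_X, Polynomial.eval_C]
  have hlin : ∀ i, (l i).natDegree ≤ 1 := by
    intro i
    change (Polynomial.X * Polynomial.C (a i) + Polynomial.C (m i)).natDegree ≤ 1
    compute_degree
  have hmon : ∀ (k : σ →₀ ℕ) (t : Finset σ),
      (∏ i ∈ t, l i ^ k i).natDegree ≤ ∑ i ∈ t, k i ∧
      (∏ i ∈ t, l i ^ k i).coeff (∑ i ∈ t, k i) = ∏ i ∈ t, a i ^ k i := by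
    intro k t
    induction t using Finset.induction_on with
    | empty => simp
    | insert i t hi ih =>
      have h1 : (l i ^ k i).natDegree ≤ k i := by
        simpa using Polynomial.natDegree_pow_le_of_le (k i) (hlin i)
      have h2 : (l i ^ k i).coeff (k i) = a i ^ k i := by
        have := Polynomial.coeff_pow_of_natDegree_le (m := k i) (hlin i)
        rw [mul_one] at this
        simpa [hl, Polynomial.coeff_C] using this
      rw [Finset.prod_insert hi, Finset.sum_insert hi, Finset.prod_insert hi]
      refine ⟨Polynomial.natDegree_mul_le_of_le h1 ih.1, ?_⟩
      rw [Polynomial.coeff_mul_add_eq_of_natDegree_le h1 ih.1, h2, ih.2]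
  have hqsum : q = ∑ k ∈ p.support, algebraMap ℝ (Polynomial ℂ) (p.coeff k) *
      ∏ i, l i ^ k i := by rw [hq, aeval_def, eval₂_eq']
  have hdeg : ∀ k ∈ p.support, ∑ i, k i = d := by
    intro k hk
    rw [← degree_eq_of_mem_support hp hk]
    exact (Finsupp.degree_eq_sum k).symm
  have hqdeg : q.natDegree ≤ d := by
    rw [hqsum]
    refine Polynomial.natDegree_sum_le_of_forall_le _ _ fun k hk => ?_
    rw [Polynomial.algebraMap_apply]
    refine (Polynomial.natDegree_C_mul_le _ _).trans ?_
    rw [← hdeg k hk]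
    exact (hmon k Finset.univ).1
  have hqcoeff : q.coeff d = aeval a p := by
    rw [hqsum, Polynomial.finsetSum_coeff, aeval_def, eval₂_eq']
    refine Finset.sum_congr rfl fun k hk => ?_
    rw [Polynomial.algebraMap_apply, Polynomial.coeff_C_mul, ← hdeg k hk, (hmon k _).2]
  have hnd : q.natDegree = d :=
    le_antisymm hqdeg (Polynomial.le_natDegree_of_ne_zero (by rwa [hqcoeff]))
  have hlead : q.leadingCoeff = aeval a p := by rw [Polynomial.leadingCoeff, hnd, hqcoeff]
  have hsplit := IsAlgClosed.splits q
  refine ⟨q.roots, by rw [← hsplit.natDegree_eq_card_roots, hnd], fun z => ?_⟩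
  rw [← heval, ← hlead, hsplit.eval_eq_prod_roots]

theorem continuous_aeval {τ : Type*} [TopologicalSpace τ] (p : MvPolynomial σ ℝ) {f : τ → σ → ℂ}
    (hf : Continuous f) : Continuous fun t => aeval (f t) p := by
  simp only [aeval_def, ← eval_map]
  exact (MvPolynomial.continuous_eval _).comp hf

theorem aeval_smul_of_isHomogeneous {R : Type*} [CommRing R] [Algebra ℝ R]
    {p : MvPolynomial σ ℝ} {d : ℕ} (hp : p.IsHomogeneous d) (c : R) (x : σ → R) :
    aeval (fun i => c * x i) p = c ^ d * aeval x p := by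
  rw [aeval_def, aeval_def, eval₂_eq, eval₂_eq, Finset.mul_sum]
  refine Finset.sum_congr rfl fun k hk => ?_
  rw [← degree_eq_of_mem_support hp hk, Finsupp.degree_apply, ← Finset.prod_pow_eq_pow_sum]
  simp only [mul_pow, Finset.prod_mul_distrib]
  ring

theorem aeval_complex_ofReal (p : MvPolynomial σ ℝ) (x : σ → ℝ) :
    aeval (fun i => (x i : ℂ)) p = ((aeval x p : ℝ) : ℂ) := by
  exact aeval_algebraMap_apply ℂ x p

/-- Homotopy principle. The zeros of `z ↦ p(z a + m + t² n)` depend continuously on the real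
parameter `t` and never lie on the real axis; if none of them is in the upper half-plane for
`t = 0`, then none is for `t = 1`. The factor `t²` lets `t` range over the connected space `ℝ` while
the coefficient of `n` stays nonnegative. -/
theorem aeval_ne_zero_of_homotopy [Fintype σ] {p : MvPolynomial σ ℝ} {d : ℕ}
    (hp : p.IsHomogeneous d) {a m n : σ → ℂ} (ha : aeval a p ≠ 0)
    (hreal : ∀ x t : ℝ, aeval (fun i => (x : ℂ) * a i + (m i + (t : ℂ) ^ 2 * n i)) p ≠ 0)
    (h0 : ∀ z : ℂ, 0 < z.im → aeval (fun i => z * a i + m i) p ≠ 0) {z : ℂ} (hz : 0 < z.im) :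
    aeval (fun i => z * a i + (m i + n i)) p ≠ 0 := by
  set F : ℝ → ℂ → ℂ := fun t z => aeval (fun i => z * a i + (m i + (t : ℂ) ^ 2 * n i)) p with hF
  set T : Set ℝ := {t | ∀ z : ℂ, 0 < z.im → F t z ≠ 0} with hT
  have hFc : Continuous fun y : ℝ × ℂ => F y.1 y.2 :=
    continuous_aeval p (by fun_prop)
  -- For `t ∈ T` every root of `F t` has nonpositive imaginary part, so it is at distance at least
  -- `z.im` from `z`; this makes membership in `T` a closed condition.
  have hTeq : T = ⋂ z : ℂ, ⋂ _ : 0 < z.im, {t | ‖aeval a p‖ * z.im ^ d ≤ ‖F t z‖} := by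
    ext t
    simp only [hT, Set.mem_ofPred_eq, Set.mem_iInter]
    refine ⟨fun h z hz => ?_, fun h z hz h' => ?_⟩
    · obtain ⟨s, hs, hs'⟩ := exists_multiset_aeval_line hp a (fun i => m i + (t : ℂ) ^ 2 * n i) ha
      have hroot : ∀ r ∈ s, r.im ≤ 0 := by
        intro r hr
        by_contra! hr'
        refine h r hr' ?_
        rw [hF]
        simp only
        rw [hs' r, Multiset.prod_eq_zero, mul_zero]
        exact Multiset.mem_map.2 ⟨r, hr, sub_self r⟩
      simp only [hF]
      rw [hs' z, norm_mul]
      refine mul_le_mul_of_nonneg_left ?_ (norm_nonneg _)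
      rw [← hs]
      clear hs hs'
      induction s using Multiset.induction_on with
      | empty => simp
      | cons r s ih =>
        have h1 := hroot r (Multiset.mem_cons_self r s)
        have h2 : z.im ≤ ‖z - r‖ := by
          refine le_trans ?_ (Complex.abs_im_le_norm _)
          rw [Complex.sub_im]
          exact le_trans (by linarith) (le_abs_self _)
        rw [Multiset.map_cons, Multiset.prod_cons, Multiset.card_cons, pow_succ', norm_mul]
        exact mul_le_mul h2 (ih fun r hr => hroot r (Multiset.mem_cons_of_mem hr))
          (by positivity) (norm_nonneg _)
    · have h1 := h z hz
      rw [h', norm_zero] at h1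
      exact absurd h1 (not_le.2 (by positivity))
  have hclosed : IsClosed T := by
    rw [hTeq]
    refine isClosed_iInter fun z => isClosed_iInter fun _ => ?_
    exact isClosed_le continuous_const (continuous_aeval p (by fun_prop)).norm
  -- The closed upper half-plane together with `∞` is covered by two compact sets, the second one
  -- in the coordinate `u = 1 / z`.
  have hopen : IsOpen T := by
    rw [isOpen_iff_eventually]
    intro t₀ ht₀
    have hup : ∀ z : ℂ, 0 ≤ z.im → F t₀ z ≠ 0 := by
      intro z hz
      rcases hz.lt_or_eq with h | h
      · exact ht₀ z h
      · have hz' : z = (z.re : ℂ) := Complex.ext rfl (by simp [← h])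
        rw [hz']
        exact hreal z.re t₀
    set G : ℝ → ℂ → ℂ := fun t u => aeval (fun i => a i + u * (m i + (t : ℂ) ^ 2 * n i)) p with hG
    have hGc : Continuous fun y : ℝ × ℂ => G y.1 y.2 :=
      continuous_aeval p (by fun_prop)
    have hFG : ∀ t : ℝ, ∀ u : ℂ, u ≠ 0 → G t u = u ^ d * F t u⁻¹ := by
      intro t u hu
      simp only [hF, hG]
      rw [← aeval_smul_of_isHomogeneous hp]
      congr 2
      ext i
      field_simp
    have hK₁ : IsCompact (Metric.closedBall (0 : ℂ) 1 ∩ {z : ℂ | 0 ≤ z.im}) :=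
      (isCompact_closedBall _ _).inter_right (isClosed_le continuous_const Complex.continuous_im)
    have hK₂ : IsCompact (Metric.closedBall (0 : ℂ) 1 ∩ {z : ℂ | z.im ≤ 0}) :=
      (isCompact_closedBall _ _).inter_right (isClosed_le Complex.continuous_im continuous_const)
    have e₁ := hK₁.eventually_forall_of_forall_eventually (x₀ := t₀)
      (P := fun t z => F t z ≠ 0) fun z hz => hFc.continuousAt.eventually_ne (hup z hz.2)
    have e₂ := hK₂.eventually_forall_of_forall_eventually (x₀ := t₀)
      (P := fun t u => G t u ≠ 0) fun u hu => by
        refine hGc.continuousAt.eventually_ne ?_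
        simp only
        by_cases hu0 : u = 0
        · simpa [hG, hu0] using ha
        · rw [hFG _ _ hu0]
          refine mul_ne_zero (pow_ne_zero _ hu0) (hup _ ?_)
          rw [Complex.inv_im]
          exact div_nonneg (neg_nonneg.2 hu.2) (Complex.normSq_nonneg _)
    filter_upwards [e₁, e₂] with t ht₁ ht₂ z hz
    by_cases hz1 : ‖z‖ ≤ 1
    · exact ht₁ z ⟨by simpa using hz1, hz.le⟩
    · have hz0 : z ≠ 0 := by rintro rfl; simp at hz
      have h1 : G t z⁻¹ ≠ 0 := by
        refine ht₂ _ ⟨?_, ?_⟩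
        · simpa using inv_le_one_of_one_le₀ (not_le.1 hz1).le
        · rw [Set.mem_ofPred_eq, Complex.inv_im]
          exact div_nonpos_of_nonpos_of_nonneg (by linarith) (Complex.normSq_nonneg _)
      rw [hFG _ _ (inv_ne_zero hz0), inv_inv] at h1
      exact right_ne_zero_of_mul h1
  have huniv : T = Set.univ := IsClopen.eq_univ ⟨hclosed, hopen⟩
    ⟨0, fun z hz => by simpa [hF] using h0 z hz⟩
  have h1 : (1 : ℝ) ∈ T := huniv ▸ Set.mem_univ _
  simpa [hF] using h1 z hz

/-! ### The hyperbolicity cone -/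

/-- `p` is hyperbolic with respect to `e`: the zeros `v` of `p(x + v e)` are real for real `x`. For
homogeneous `p` it is enough to exclude zeros in the upper half-plane, since `v ↦ -v` exchanges the
half-planes. -/
def IsHyperbolicAt (p : MvPolynomial σ ℝ) (e : σ → ℝ) : Prop :=
  ∀ (x : σ → ℝ) (v : ℂ), 0 < v.im → aeval (fun i => (x i : ℂ) + v * e i) p ≠ 0

/-- The open hyperbolicity cone: the `a` such that `p(a + t e)` has only negative real zeros `t`. -/
def openCone (p : MvPolynomial σ ℝ) (e : σ → ℝ) : Set (σ → ℝ) :=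
  {a | ∀ t : ℝ, 0 ≤ t → aeval (fun i => a i + t * e i) p ≠ 0}

variable {p : MvPolynomial σ ℝ} {d : ℕ} {e a b : σ → ℝ}

theorem aeval_ne_zero_of_mem_openCone (ha : a ∈ openCone p e) : aeval a p ≠ 0 := by
  simpa using ha 0 le_rfl

theorem aeval_ofReal_ne_zero_of_mem_openCone (ha : a ∈ openCone p e) :
    aeval (fun i => (a i : ℂ)) p ≠ 0 := by
  rw [aeval_complex_ofReal]
  exact_mod_cast aeval_ne_zero_of_mem_openCone ha

theorem aeval_two_ne_zero (hp : p.IsHomogeneous d) (he : IsHyperbolicAt p e)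
    (ha : a ∈ openCone p e) {z v : ℂ} (hz : 0 < z.im) (hv : 0 < v.im) :
    aeval (fun i => z * a i + v * e i) p ≠ 0 := by
  have hz0 : z ≠ 0 := by rintro rfl; simp at hz
  have hvz : v = z * (v / z) := by field_simp
  set t := v / z with ht
  have h1 : (fun i => z * (a i : ℂ) + v * e i) = fun i => z * ((a i : ℂ) + t * e i) := by
    ext i; rw [hvz]; ring
  rw [h1, aeval_smul_of_isHomogeneous hp]
  refine mul_ne_zero (pow_ne_zero _ hz0) ?_
  rcases lt_trichotomy t.im 0 with h | h | h
  · have h2 := he (fun i => - a i) (-t) (by simpa using h)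
    have h3 : (fun i => ((- a i : ℝ) : ℂ) + -t * e i) = fun i => (-1) * ((a i : ℂ) + t * e i) := by
      ext i; push_cast; ring
    rw [h3, aeval_smul_of_isHomogeneous hp] at h2
    exact right_ne_zero_of_mul h2
  · have h2 : t = (t.re : ℂ) := Complex.ext rfl (by simp [h])
    have h3 : 0 ≤ t.re := by
      rw [hvz, h2, Complex.im_mul_ofReal] at hv
      exact (pos_of_mul_pos_right hv hz.le).le
    rw [h2]
    have h4 := aeval_complex_ofReal p (fun i => a i + t.re * e i)
    push_cast at h4
    rw [h4]
    exact_mod_cast ha _ h3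
  · exact he a t h

/-- Gårding: for `a`, `b` in the open cone, `(z, w, v) ↦ p(z a + w b + v e)` has no zeros in the
product of three upper half-planes. -/
theorem aeval_three_ne_zero [Fintype σ] (hp : p.IsHomogeneous d) (he : IsHyperbolicAt p e)
    (ha : a ∈ openCone p e) (hb : b ∈ openCone p e) {z w v : ℂ}
    (hz : 0 < z.im) (hw : 0 < w.im) (hv : 0 < v.im) :
    aeval (fun i => z * a i + w * b i + v * e i) p ≠ 0 := by
  -- `w` is real at first: deform `w` to `0`.
  have key : ∀ (w : ℝ) (z : ℂ), 0 < z.im →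
      aeval (fun i => z * (a i : ℂ) + (v * e i + w * b i)) p ≠ 0 := by
    intro w z hz
    refine aeval_ne_zero_of_homotopy hp (m := fun i => v * e i) (n := fun i => w * b i)
      (aeval_ofReal_ne_zero_of_mem_openCone ha) (fun x t => ?_)
      (fun z hz => aeval_two_ne_zero hp he ha hz hv) hz
    have := he (fun i => x * a i + t ^ 2 * w * b i) v hv
    push_cast at this
    convert this using 4
    ring
  -- Then `w` is the main variable, and `z` is deformed to `0`.
  have := aeval_ne_zero_of_homotopy hp (m := fun i => v * e i) (n := fun i => z * a i)
      (aeval_ofReal_ne_zero_of_mem_openCone hb) (fun x t => ?_)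
      (fun z hz => aeval_two_ne_zero hp he hb hz hv) hw
  · convert this using 4
    ring
  · rcases eq_or_ne t 0 with rfl | ht
    · have := he (fun i => x * b i) v hv
      push_cast at this
      convert this using 4
      simp
    · have hz' : 0 < ((t : ℂ) ^ 2 * z).im := by
        rw [← Complex.ofReal_pow, Complex.im_ofReal_mul]
        positivity
      convert key x _ hz' using 4
      ring

theorem exists_sub_mem_openCone (ha : a ∈ openCone p e) :
    ∃ ε : ℝ, 0 < ε ∧ (fun i => a i - ε * e i) ∈ openCone p e := by
  have hc : Continuous fun t : ℝ => aeval (fun i => a i - t * e i) p := by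
    simp only [aeval_eq_eval]
    exact (MvPolynomial.continuous_eval _).comp (by fun_prop)
  have h0 : ∀ᶠ t in 𝓝 (0 : ℝ), aeval (fun i => a i - t * e i) p ≠ 0 :=
    hc.continuousAt.eventually_ne (by simpa using aeval_ne_zero_of_mem_openCone ha)
  obtain ⟨δ, hδ, h⟩ := Metric.eventually_nhds_iff.1 h0
  refine ⟨δ / 2, by positivity, fun t ht => ?_⟩
  rcases lt_or_ge t (δ / 2) with h1 | h1
  · convert h (y := δ / 2 - t) ?_ using 4
    · ring
    · rw [Real.dist_eq, sub_zero, abs_of_pos (by linarith)]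
      linarith
  · convert ha (t - δ / 2) (by linarith) using 4
    ring

theorem aeval_add_ne_zero [Fintype σ] (hp : p.IsHomogeneous d) (he : IsHyperbolicAt p e)
    (ha : a ∈ openCone p e) (hb : b ∈ openCone p e) {z w : ℂ} (hz : 0 < z.im) (hw : 0 < w.im) :
    aeval (fun i => z * a i + w * b i) p ≠ 0 := by
  obtain ⟨ε, hε, ha'⟩ := exists_sub_mem_openCone ha
  have := aeval_three_ne_zero hp he ha' hb hz hw (v := z * ε)
    (by rw [Complex.im_mul_ofReal]; positivity)
  convert this using 4
  push_cast
  ring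

theorem add_mem_openCone [Fintype σ] (hp : p.IsHomogeneous d) (he : IsHyperbolicAt p e)
    (ha : a ∈ openCone p e) (hb : b ∈ openCone p e) :
    (fun i => a i + b i) ∈ openCone p e := by
  intro t ht h
  have hb' : (fun i => b i + t * e i) ∈ openCone p e := by
    intro s hs
    convert hb (t + s) (by positivity) using 4
    ring
  have h1 := aeval_add_ne_zero hp he ha hb' (z := Complex.I) (w := Complex.I) (by simp) (by simp)
  have h2 : (fun i => Complex.I * (a i : ℂ) + Complex.I * ((b i + t * e i : ℝ) : ℂ)) =
      fun i => Complex.I * ((a i + b i + t * e i : ℝ) : ℂ) := by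
    ext i; push_cast; ring
  rw [h2, aeval_smul_of_isHomogeneous hp, aeval_complex_ofReal, h] at h1
  simp at h1

theorem smul_mem_openCone (hp : p.IsHomogeneous d) (ha : a ∈ openCone p e) {c : ℝ} (hc : 0 < c) :
    (fun i => c * a i) ∈ openCone p e := by
  intro t ht
  have h1 : (fun i => c * a i + t * e i) = fun i => c * (a i + t / c * e i) := by
    ext i; field_simp
  rw [h1, aeval_smul_of_isHomogeneous hp]
  exact mul_ne_zero (pow_ne_zero _ hc.ne') (ha _ (by positivity))

/-- The open cone is star-shaped with respect to `e`, so `p` has the sign of `p(e)` on it. -/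
theorem aeval_pos_of_mem_openCone (hp : p.IsHomogeneous d) (hpos : 0 < aeval e p)
    (ha : a ∈ openCone p e) : 0 < aeval a p := by
  by_contra! hneg
  have hc : Continuous fun t : ℝ => aeval (fun i => (1 - t) * a i + t * e i) p := by
    simp only [aeval_eq_eval]
    exact (MvPolynomial.continuous_eval _).comp (by fun_prop)
  obtain ⟨t, ⟨ht0, ht1⟩, ht⟩ := intermediate_value_Icc zero_le_one hc.continuousOn
    (show (0 : ℝ) ∈ Set.Icc _ _ from ⟨by simpa using hneg, by simpa using hpos.le⟩)
  simp only at ht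
  rcases ht1.lt_or_eq with h | rfl
  · have h' : 0 < 1 - t := by linarith
    have h1 : (fun i => (1 - t) * a i + t * e i) =
        fun i => (1 - t) * (a i + t / (1 - t) * e i) := by
      ext i; field_simp
    rw [h1, aeval_smul_of_isHomogeneous hp] at ht
    exact mul_ne_zero (pow_ne_zero _ h'.ne') (ha _ (by positivity)) ht
  · simp at ht
    exact hpos.ne' ht

/-! ### The midpoint inequality -/

/-- If `ζ` is not a negative real number, `ζ` and `1` can be rotated simultaneously into the open
upper half-plane. -/
theorem exists_mul_im_pos {ζ : ℂ} (h : 0 ≤ ζ.re ∨ ζ.im ≠ 0) (h0 : ζ ≠ 0) :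
    ∃ u : ℂ, 0 < u.im ∧ 0 < (u * ζ).im := by
  rcases lt_trichotomy ζ.im 0 with hi | hi | hi
  · refine ⟨⟨-(|ζ.re| + 1), -ζ.im⟩, by simpa using hi, ?_⟩
    simp only [Complex.mul_im]
    nlinarith [neg_abs_le ζ.re, le_abs_self ζ.re]
  · refine ⟨Complex.I, by simp, ?_⟩
    have h1 : ζ.re ≠ 0 := fun h1 => h0 (Complex.ext h1 hi)
    have h2 : 0 ≤ ζ.re := h.resolve_right fun h2 => h2 hi
    simpa using lt_of_le_of_ne h2 h1.symm
  · refine ⟨⟨|ζ.re| + 1, ζ.im⟩, by simpa using hi, ?_⟩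
    simp only [Complex.mul_im]
    nlinarith [neg_abs_le ζ.re, le_abs_self ζ.re]

/-- The special case `p(a) = p(b)` of the concavity of `p^{1/d}` on the cone. All roots of
`z ↦ p(z a + b)` are negative, say `-ρ_i`, with `∏ ρ_i = p(b) / p(a) = 1`, and
`p(a + b) = p(a) ∏ (1 + ρ_i)`; then use `1 + ρ ≥ 2 √ρ`. -/
theorem aeval_le_aeval_midpoint [Fintype σ] (hp : p.IsHomogeneous d) (he : IsHyperbolicAt p e)
    (hpos : 0 < aeval e p) (ha : a ∈ openCone p e) (hb : b ∈ openCone p e)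
    (hab : aeval a p = aeval b p) :
    aeval a p ≤ aeval (fun i => (1 / 2 : ℝ) * (a i + b i)) p := by
  obtain ⟨s, hs, hs'⟩ := exists_multiset_aeval_line hp (fun i => (a i : ℂ)) (fun i => (b i : ℂ))
    (aeval_ofReal_ne_zero_of_mem_openCone ha)
  have hroot : ∀ r ∈ s, r.im = 0 ∧ r.re ≤ 0 := by
    intro r hr
    have hz : aeval (fun i => r * (a i : ℂ) + b i) p = 0 := by
      rw [hs' r, Multiset.prod_eq_zero, mul_zero]
      exact Multiset.mem_map.2 ⟨r, hr, sub_self r⟩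
    by_contra hcon
    have hr0 : r ≠ 0 := by rintro rfl; simp at hcon
    have hr1 : 0 ≤ r.re ∨ r.im ≠ 0 := by
      by_contra! h'
      exact hcon ⟨h'.2, h'.1.le⟩
    obtain ⟨u, hu, hur⟩ := exists_mul_im_pos hr1 hr0
    refine aeval_add_ne_zero hp he ha hb hur hu ?_
    have h1 : (fun i => u * r * (a i : ℂ) + u * b i) = fun i => u * (r * (a i : ℂ) + b i) := by
      ext i; ring
    rw [h1, aeval_smul_of_isHomogeneous hp, hz, mul_zero]
  have hA := aeval_pos_of_mem_openCone hp hpos ha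
  have hAB := aeval_pos_of_mem_openCone hp hpos (add_mem_openCone hp he ha hb)
  have hn0 : (s.map fun r => ‖r‖).prod = 1 := by
    have h := hs' 0
    simp only [zero_mul, zero_add, zero_sub] at h
    rw [aeval_complex_ofReal, aeval_complex_ofReal, ← hab] at h
    have h2 : (s.map fun r => -r).prod = 1 :=
      mul_left_cancel₀ (Complex.ofReal_ne_zero.2 hA.ne') (by rw [← h, mul_one])
    have h3 := congrArg (fun z : ℂ => ‖z‖) h2
    have h4 := map_multiset_prod (normHom : ℂ →*₀ ℝ) (s.map fun r => -r)
    simp only [Multiset.map_map] at h4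
    simpa [h2] using h4.symm
  have hn1 : aeval (fun i => a i + b i) p = aeval a p * (s.map fun r => 1 + ‖r‖).prod := by
    have h := hs' 1
    have h1 : (fun i => (1 : ℂ) * (a i : ℂ) + b i) = fun i => ((a i + b i : ℝ) : ℂ) := by
      ext i; push_cast; ring
    have h2 : (s.map fun r => 1 - r) = s.map fun r => (((1 + ‖r‖ : ℝ)) : ℂ) := by
      refine Multiset.map_congr rfl fun r hr => ?_
      have hr' : r = (r.re : ℂ) := Complex.ext rfl (by simp [(hroot r hr).1])
      rw [hr', Complex.norm_real, Real.norm_of_nonpos (hroot r hr).2]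
      push_cast
      ring
    have h3 := map_multiset_prod Complex.ofRealHom (s.map fun r => 1 + ‖r‖)
    rw [Multiset.map_map] at h3
    rw [h1, h2, aeval_complex_ofReal, aeval_complex_ofReal] at h
    have h4 : ((s.map fun r => (((1 + ‖r‖ : ℝ)) : ℂ))).prod =
      (((s.map fun r => 1 + ‖r‖).prod : ℝ) : ℂ) := h3.symm
    rw [h4] at h
    exact_mod_cast h
  have hamgm : ∀ s : Multiset ℂ, (2 ^ Multiset.card s) ^ 2 * (s.map fun r => ‖r‖).prod ≤
      ((s.map fun r => 1 + ‖r‖).prod) ^ 2 ∧ 0 ≤ (s.map fun r => 1 + ‖r‖).prod ∧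
      0 ≤ (s.map fun r => ‖r‖).prod := by
    intro s
    induction s using Multiset.induction_on with
    | empty => simp
    | cons r s ih =>
      obtain ⟨h1, h2, h3⟩ := ih
      simp only [Multiset.map_cons, Multiset.prod_cons, Multiset.card_cons]
      refine ⟨?_, by positivity, by positivity⟩
      have h4 : 4 * ‖r‖ ≤ (1 + ‖r‖) ^ 2 := by nlinarith [sq_nonneg (1 - ‖r‖)]
      calc (2 ^ (Multiset.card s + 1)) ^ 2 * (‖r‖ * (s.map fun r => ‖r‖).prod)
          = (4 * ‖r‖) * ((2 ^ Multiset.card s) ^ 2 * (s.map fun r => ‖r‖).prod) := by ring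
        _ ≤ (1 + ‖r‖) ^ 2 * ((s.map fun r => 1 + ‖r‖).prod) ^ 2 := by gcongr
        _ = _ := by ring
  have h2d : (2 : ℝ) ^ d ≤ (s.map fun r => 1 + ‖r‖).prod := by
    have h := (hamgm s).1
    rw [hn0, mul_one, hs] at h
    exact (pow_le_pow_iff_left₀ (by positivity) (hamgm s).2.1 two_ne_zero).1 h
  rw [aeval_smul_of_isHomogeneous hp, hn1]
  calc aeval a p = (1 / 2) ^ d * (aeval a p * 2 ^ d) := by
        rw [one_div, inv_pow]; field_simp
    _ ≤ _ := by gcongr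

end Hyperbolic

/-! ### Linear principal minor polynomials on symmetric matrices -/

namespace LPM

variable {n : ℕ}

theorem evalAt_eq_aeval_sym2 {R : Type*} [CommRing R] [Algebra ℝ R] (x : Sym2 (Fin n) → R)
    (P : SymPoly n) : evalAt (Matrix.of fun i j => x s(i, j)) P = aeval x P := by
  unfold evalAt
  congr 2
  ext e
  induction e with
  | _ i j => rcases le_total i j with h | h <;> simp [h, Sym2.eq_swap]

/-- The coordinates of a matrix on unordered pairs, chosen so that `evalAt A P` is by definition
`aeval (coords A) P`. -/
def coords (A : Matrix (Fin n) (Fin n) ℝ) : Sym2 (Fin n) → ℝ := fun e => A e.inf e.sup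

theorem coords_mk {A : Matrix (Fin n) (Fin n) ℝ} (hA : A.IsSymm) (i j : Fin n) :
    coords A s(i, j) = A i j := by
  rcases le_total i j with h | h
  · simp [coords, h]
  · simp [coords, h, hA.apply i j]

theorem isHyperbolicAt_of_isPSDStable {P : SymPoly n} (h : IsPSDStable P) :
    IsHyperbolicAt P (coords (1 : Matrix (Fin n) (Fin n) ℝ)) := by
  intro x v hv
  rw [← evalAt_eq_aeval_sym2]
  refine h _ ?_ ?_
  · ext i j
    simp [Sym2.eq_swap]
  · have : (Matrix.of fun i j : Fin n => ((x s(i, j) : ℂ) +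
        v * (coords (1 : Matrix (Fin n) (Fin n) ℝ) s(i, j) : ℂ))).map Complex.im =
        v.im • (1 : Matrix (Fin n) (Fin n) ℝ) := by
      ext i j
      simp only [Matrix.map_apply, Matrix.of_apply, Complex.add_im, Complex.ofReal_im, zero_add,
        Complex.im_mul_ofReal, Matrix.smul_apply, smul_eq_mul, coords_mk Matrix.isSymm_one]
    rw [this]
    exact Matrix.PosDef.one.smul hv

theorem evalAt_sum_minors {A : Matrix (Fin n) (Fin n) ℝ} (hA : A.IsSymm)
    (c : Finset (Fin n) → ℝ) :
    evalAt A (∑ J : Finset (Fin n), C (c J) * ((genericMatrix n).submatrix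
      (fun i : J => (i : Fin n)) (fun i : J => (i : Fin n))).det) =
    ∑ J : Finset (Fin n), c J *
      (A.submatrix (fun i : J => (i : Fin n)) (fun i : J => (i : Fin n))).det := by
  have hX := fun i j => evalAt_X hA i j
  unfold evalAt at hX ⊢
  rw [map_sum]
  refine Finset.sum_congr rfl fun J _ => ?_
  rw [map_mul, aeval_C, AlgHom.map_det]
  congr 2
  ext i j
  simp only [AlgHom.mapMatrix_apply, Matrix.map_apply, Matrix.submatrix_apply, genericMatrix,
    Matrix.of_apply]
  exact hX _ _

/-- The diagonal congruence `A ↦ D A D` by signs. -/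
def signConj (s : Fin n → ℝ) (A : Matrix (Fin n) (Fin n) ℝ) : Matrix (Fin n) (Fin n) ℝ :=
  Matrix.of fun i j => s i * A i j * s j

theorem isSymm_signConj (s : Fin n → ℝ) {A : Matrix (Fin n) (Fin n) ℝ} (hA : A.IsSymm) :
    (signConj s A).IsSymm := by
  ext i j
  simp only [signConj, Matrix.transpose_apply, Matrix.of_apply, hA.apply i j]
  ring

/-- Principal minors, hence lpm polynomials, do not change under congruence by signs. -/
theorem evalAt_signConj {P : SymPoly n} (hP : IsLPM P) {s : Fin n → ℝ} (hs : ∀ i, s i * s i = 1)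
    {A : Matrix (Fin n) (Fin n) ℝ} (hA : A.IsSymm) :
    evalAt (signConj s A) P = evalAt A P := by
  obtain ⟨c, rfl⟩ := hP
  rw [evalAt_sum_minors hA, evalAt_sum_minors (isSymm_signConj s hA)]
  refine Finset.sum_congr rfl fun J _ => ?_
  have : (signConj s A).submatrix (fun i : J => (i : Fin n)) (fun i : J => (i : Fin n)) =
      Matrix.diagonal (fun i : J => s i) *
        A.submatrix (fun i : J => (i : Fin n)) (fun i : J => (i : Fin n)) *
        Matrix.diagonal (fun i : J => s i) := by
    ext i j
    simp [signConj]
  rw [this, Matrix.det_mul, Matrix.det_mul, Matrix.det_diagonal, mul_right_comm,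
    ← Finset.prod_mul_distrib]
  simp [hs]

/-- The symmetric matrices in the open hyperbolicity cone of `P` with respect to `I`. -/
def openMatrixCone (P : SymPoly n) : Set (Matrix (Fin n) (Fin n) ℝ) :=
  {A | A.IsSymm ∧ coords A ∈ openCone P (coords (1 : Matrix (Fin n) (Fin n) ℝ))}

theorem signConj_mem_openMatrixCone {P : SymPoly n} (hP : IsLPM P) {s : Fin n → ℝ}
    (hs : ∀ i, s i * s i = 1) {A : Matrix (Fin n) (Fin n) ℝ} (hA : A ∈ openMatrixCone P) :
    signConj s A ∈ openMatrixCone P := by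
  refine ⟨isSymm_signConj s hA.1, fun t ht => ?_⟩
  have h1 : evalAt (signConj s (A + t • (1 : Matrix (Fin n) (Fin n) ℝ))) P ≠ 0 := by
    rw [evalAt_signConj hP hs (hA.1.add (Matrix.isSymm_one.smul t))]
    exact hA.2 t ht
  have h2 : signConj s (A + t • (1 : Matrix (Fin n) (Fin n) ℝ)) =
      signConj s A + t • (1 : Matrix (Fin n) (Fin n) ℝ) := by
    ext i j
    rcases eq_or_ne i j with rfl | hij
    · simp only [signConj, Matrix.of_apply, Matrix.add_apply, Matrix.smul_apply,
        Matrix.one_apply_eq, smul_eq_mul]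
      linear_combination t * hs i
    · simp [signConj, hij]
  rw [h2] at h1
  exact h1

open Classical in
/-- All entries `A i j` are replaced by zero for which some member of `T` contains exactly one of
`i` and `j`. -/
noncomputable def cut (T : Finset (Finset (Fin n))) (A : Matrix (Fin n) (Fin n) ℝ) :
    Matrix (Fin n) (Fin n) ℝ :=
  Matrix.of fun i j => if ∀ S ∈ T, (i ∈ S ↔ j ∈ S) then A i j else 0

/-- Cutting along one more set `S` is the midpoint of `A` and its sign conjugate, with sign `-1`
on `S`, so the hyperbolic midpoint inequality applies. -/
theorem cut_mem_and_evalAt_le {P : SymPoly n} {d : ℕ} (hhom : P.IsHomogeneous d) (hlpm : IsLPM P)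
    (hstable : IsPSDStable P) (hpos : 0 < evalAt (1 : Matrix (Fin n) (Fin n) ℝ) P)
    {A : Matrix (Fin n) (Fin n) ℝ} (hA : A ∈ openMatrixCone P) (T : Finset (Finset (Fin n))) :
    cut T A ∈ openMatrixCone P ∧ evalAt A P ≤ evalAt (cut T A) P := by
  classical
  have hyp := isHyperbolicAt_of_isPSDStable hstable
  induction T using Finset.induction_on with
  | empty =>
    have : cut ∅ A = A := by ext i j; simp [cut]
    rw [this]
    exact ⟨hA, le_rfl⟩
  | insert S T _ ih =>
    obtain ⟨hB, hle⟩ := ih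
    set B := cut T A with hBdef
    set s : Fin n → ℝ := fun i => if i ∈ S then -1 else 1 with hsdef
    have hs : ∀ i, s i * s i = 1 := by
      intro i
      by_cases hi : i ∈ S <;> simp [hsdef, hi]
    have hB' := signConj_mem_openMatrixCone hlpm hs hB
    have hcut : cut (insert S T) A =
        Matrix.of fun i j => (1 / 2 : ℝ) * (B i j + signConj s B i j) := by
      ext i j
      by_cases hT : ∀ S' ∈ T, (i ∈ S' ↔ j ∈ S')
      · by_cases hi : i ∈ S <;> by_cases hj : j ∈ S <;>
          simp [cut, hBdef, signConj, hsdef, hi, hj] <;> grind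
      · have hT' : ¬ ∀ S' ∈ insert S T, (i ∈ S' ↔ j ∈ S') := fun h =>
          hT fun S' hS' => h S' (Finset.mem_insert_of_mem hS')
        simp only [cut, hBdef, signConj, Matrix.of_apply, if_neg hT, if_neg hT']
        simp
    have hcoords : coords (cut (insert S T) A) =
        fun e => (1 / 2 : ℝ) * (coords B e + coords (signConj s B) e) := by
      rw [hcut]; rfl
    have hmid := aeval_le_aeval_midpoint hhom hyp hpos hB.2 hB'.2
      (evalAt_signConj hlpm hs hB.1).symm
    refine ⟨⟨?_, ?_⟩, hle.trans ?_⟩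
    · rw [hcut]
      ext i j
      simp [hB.1.apply i j, hB'.1.apply i j]
    · rw [hcoords]
      exact smul_mem_openCone hhom (add_mem_openCone hhom hyp hB.2 hB'.2) (by norm_num)
    · rw [← hcoords] at hmid
      exact hmid

theorem blockProj_eq_cut (Q : Finpartition (Finset.univ : Finset (Fin n)))
    (A : Matrix (Fin n) (Fin n) ℝ) : blockProj Q A = cut Q.parts A := by
  classical
  ext i j
  simp only [blockProj, cut, Matrix.of_apply]
  refine if_congr ⟨?_, fun h => ?_⟩ rfl rfl
  · rintro ⟨S, hS, hi, hj⟩ S' hS'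
    refine ⟨fun h => ?_, fun h => ?_⟩
    · rwa [Q.eq_of_mem_parts hS' hS h hi]
    · rwa [Q.eq_of_mem_parts hS' hS h hj]
  · obtain ⟨S, hS, hi⟩ := Q.exists_mem (Finset.mem_univ i)
    exact ⟨S, hS, hi, (h S hS).1 hi⟩

theorem add_smul_one_mem_openMatrixCone {P : SymPoly n} {A : Matrix (Fin n) (Fin n) ℝ}
    (hA : A ∈ hyperbolicityCone P) {t : ℝ} (ht : 0 < t) :
    A + t • (1 : Matrix (Fin n) (Fin n) ℝ) ∈ openMatrixCone P := by
  refine ⟨hA.1.add (Matrix.isSymm_one.smul t), fun s hs h => ?_⟩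
  have h1 := hA.2 (-(t + s)) ?_
  · linarith
  · rw [← h]
    unfold evalAt coords
    congr 2
    ext e
    simp only [Matrix.sub_apply, Matrix.add_apply, Matrix.smul_apply, smul_eq_mul]
    ring

theorem continuous_evalAt_add_smul_one (P : SymPoly n) (A : Matrix (Fin n) (Fin n) ℝ) :
    Continuous fun t : ℝ => evalAt (A + t • (1 : Matrix (Fin n) (Fin n) ℝ)) P := by
  unfold evalAt
  simp only [aeval_eq_eval]
  refine (MvPolynomial.continuous_eval _).comp (continuous_pi fun e => ?_)
  simp only [Matrix.add_apply, Matrix.smul_apply, smul_eq_mul]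
  fun_prop

theorem blockProj_add_smul_one (Q : Finpartition (Finset.univ : Finset (Fin n)))
    (A : Matrix (Fin n) (Fin n) ℝ) (t : ℝ) :
    blockProj Q (A + t • (1 : Matrix (Fin n) (Fin n) ℝ)) =
      blockProj Q A + t • (1 : Matrix (Fin n) (Fin n) ℝ) := by
  rw [blockProj_eq_cut, blockProj_eq_cut]
  ext i j
  rcases eq_or_ne i j with rfl | hij
  · simp [cut]
  · simp [cut, hij]

end LPM

theorem theorem2 (n d : ℕ) (P : LPM.SymPoly n)
    (hhom : P.IsHomogeneous d) (hlpm : LPM.IsLPM P) (hstable : LPM.IsPSDStable P)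
    (hpos : 0 < LPM.evalAt (1 : Matrix (Fin n) (Fin n) ℝ) P)
    (Q : Finpartition (Finset.univ : Finset (Fin n)))
    (A : Matrix (Fin n) (Fin n) ℝ) (hA : A ∈ LPM.hyperbolicityCone P) :
    LPM.evalAt A P ≤ LPM.evalAt (LPM.blockProj Q A) P := by
  -- `A + t I` lies in the open cone for `t > 0`; let `t` tend to `0`.
  have hlim : ∀ B : Matrix (Fin n) (Fin n) ℝ, Tendsto
      (fun t : ℝ => LPM.evalAt (B + t • (1 : Matrix (Fin n) (Fin n) ℝ)) P)
      (𝓝[>] 0) (𝓝 (LPM.evalAt B P)) := by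
    intro B
    have h := (LPM.continuous_evalAt_add_smul_one P B).tendsto 0
    rw [zero_smul, add_zero] at h
    exact h.mono_left nhdsWithin_le_nhds
  refine le_of_tendsto_of_tendsto (hlim A) (hlim (LPM.blockProj Q A)) ?_
  filter_upwards [self_mem_nhdsWithin] with t ht
  rw [← LPM.blockProj_add_smul_one, LPM.blockProj_eq_cut]
  exact (LPM.cut_mem_and_evalAt_le hhom hlpm hstable hpos
    (LPM.add_smul_one_mem_openMatrixCone hA ht) Q.parts).2
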